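/- Let $G$ be a finite cograph (a finite simple graph with no induced path on four vertices) with vertex set $V$. Let $T$ be its cotree, that is, the rooted tree whose leaves are the vertices of $G$ and whose internal nodes are labelled parallel or series, such that every internal node has at least two children, no two parallel nodes are adjacent, no two series nodes are adjacent, and two distinct vertices of $G$ are adjacent iff their lowest common ancestor in $T$ is a series node. Let $x\notin V$ be a new vertex with neighbourhood $N(x)\subseteq V$, where $N(x)\neq\varnothing$ and $N(x)\neq V$, and let $G+x$ be the graph obtained by adding $x$ to $G$. For a node $u$ of $T$ let $T_u$ be the subtree of $T$ rooted at $u$ and let $V(u)$ be the set of its leaves. For a set $N\subseteq V$, a node $u$ is full with respect to $N$ if $V(u)\subseteq N$, hollow if $V(u)\cap N=\varnothing$, uniform if it is full or hollow, and mixed otherwise; when $N$ is not mentioned, $N=N(x)$. - A *completion* of $G+x$ is a cograph obtained from $G+x$ by adding (possibly zero) edges incident to $x$; it is *minimal* if its edge set is inclusion-minimal among all completions of $G+x$. The *insertion node* of a completion in which $x$ has neighbourhood $N'$ is the node $u$ that is mixed with respect to $N'$, all of whose children are uniform with respect to $N'$, and such that for all $y\in V\setminus V(u)$ we have $y\in N'$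 iff the lowest common ancestor of $y$ and $u$ is a series node. (There is at most one such node.) - A node is a *completion-minimal insertion node* if it is the insertion node of some minimal completion of $G+x$. - A node $u$ is *eligible* if for every strict ancestor $v$ of $u$ that is a parallel node, all the children of $v$ other than the one that is $u$ or an ancestor of $u$ are hollow. - A node $u$ is *completion-forced* (inductively) if $u$ is full, or $u$ is a parallel node all of whose children are non-hollow, or $u$ is a series node all of whose children are completion-forced. Then, for every node $u$ of $T$, the subtree $T_u$ (including $u$ itself) contains a completion-minimal insertion node if and only if $u$ is eligible, non-hollow and not completion-forced. -/

import Mathlib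

namespace CographCompletion

universe v w

/-- A cograph is a graph without induced path on four vertices. -/
def IsCograph {V : Type*} (G : SimpleGraph V) : Prop :=
  ¬ (SimpleGraph.pathGraph 4).IsIndContained G

inductive NodeKind
  | leaf
  | parallel
  | series

/-- A cotree of `G`: a finite rooted tree whose leaves are the vertices of `G` and whose internal
nodes are labelled parallel or series. In the order of the rooted tree the root is `⊥`, `u ≤ v`
means that `u` is an ancestor of `v` (possibly `u = v`), `u ⋖ v` means that `v` is a child of `u`,
and `u ⊓ v` is the lowest common ancestor of `u` and `v`. -/
structure Cotree {V : Type v} (G : SimpleGraph V) where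
  tree : RootedTree.{w}
  finite_tree : Finite tree
  kind : tree → NodeKind
  kind_eq_leaf_iff : ∀ u, kind u = NodeKind.leaf ↔ IsMax u
  leaf : V → tree
  leaf_injective : Function.Injective leaf
  range_leaf : Set.range leaf = {u | kind u = NodeKind.leaf}
  two_children : ∀ u, kind u ≠ NodeKind.leaf → ∃ v w, u ⋖ v ∧ u ⋖ w ∧ v ≠ w
  no_adjacent_parallel : ∀ u v, u ⋖ v → kind u = NodeKind.parallel → kind v ≠ NodeKind.parallel
  no_adjacent_series : ∀ u v, u ⋖ v → kind u = NodeKind.series → kind v ≠ NodeKind.series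
  adj_iff : ∀ x y, x ≠ y → (G.Adj x y ↔ kind (leaf x ⊓ leaf y) = NodeKind.series)

/-- The graph `G + x` where the new vertex `x`, written `none`, has neighbourhood `N`. -/
def addVertex {V : Type*} (G : SimpleGraph V) (N : Set V) : SimpleGraph (Option V) where
  Adj
    | none, none => False
    | none, some y => y ∈ N
    | some y, none => y ∈ N
    | some y, some z => G.Adj y z
  symm := ⟨by
    rintro (_ | y) (_ | z) h
    · exact h
    · exact h
    · exact h
    · exact SimpleGraph.Adj.symm (G := G) h⟩
  loopless := ⟨by
    rintro (_ | y) h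
    · exact h
    · exact SimpleGraph.irrefl G h⟩

/-- A (constrained cograph) completion of `G + x`: a cograph obtained from `G + x` by adding
edges that are incident to `x`. -/
def IsCompletion {V : Type*} (G : SimpleGraph V) (N : Set V) (H : SimpleGraph (Option V)) : Prop :=
  addVertex G N ≤ H ∧ (∀ y z : V, H.Adj (some y) (some z) → G.Adj y z) ∧ IsCograph H

/-- The neighbourhood of the new vertex in a graph on `V + x`. -/
def newNeighbors {V : Type*} (H : SimpleGraph (Option V)) : Set V :=
  {y | H.Adj none (some y)}

def IsFull {V : Type*} (N S : Set V) : Prop := S ⊆ N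

def IsHollow {V : Type*} (N S : Set V) : Prop := S ∩ N = ∅

def IsMixed {V : Type*} (N S : Set V) : Prop := ¬ IsFull N S ∧ ¬ IsHollow N S

def IsUniform {V : Type*} (N S : Set V) : Prop := IsFull N S ∨ IsHollow N S

namespace Cotree

variable {V : Type*} {G : SimpleGraph V}

/-- The set `V(u)` of vertices of `G` that are leaves of the subtree rooted at `u`. -/
def verts (T : Cotree G) (u : T.tree) : Set V := {y | u ≤ T.leaf y}

/-- `u` is the insertion node of a new vertex with neighbourhood `N`. -/
def IsInsertionNode (T : Cotree G) (N : Set V) (u : T.tree) : Prop :=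
  IsMixed N (T.verts u) ∧
  (∀ v, u ⋖ v → IsUniform N (T.verts v)) ∧
  ∀ y, y ∉ T.verts u → (y ∈ N ↔ T.kind (T.leaf y ⊓ u) = NodeKind.series)

/-- `u` is the insertion node associated to some inclusion-minimal completion of `G + x`. -/
def IsCompletionMinimalInsertionNode (T : Cotree G) (N : Set V) (u : T.tree) : Prop :=
  ∃ H : SimpleGraph (Option V), Minimal (IsCompletion G N) H ∧
    T.IsInsertionNode (newNeighbors H) u

def IsEligible (T : Cotree G) (N : Set V) (u : T.tree) : Prop :=
  ∀ v, v < u → T.kind v = NodeKind.parallel →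
    ∀ w, v ⋖ w → ¬ w ≤ u → IsHollow N (T.verts w)

inductive IsForced (T : Cotree G) (N : Set V) : T.tree → Prop
  | full (u : T.tree) : IsFull N (T.verts u) → IsForced T N u
  | parallel (u : T.tree) : T.kind u = NodeKind.parallel →
      (∀ v, u ⋖ v → ¬ IsHollow N (T.verts v)) → IsForced T N u
  | series (u : T.tree) : T.kind u = NodeKind.series →
      (∀ v, u ⋖ v → IsForced T N v) → IsForced T N u

end Cotree

end CographCompletion

/-!
Everything rests on the homogeneous cuts of a graph: splittings of a vertex set into two nonempty
parts with all edges, or no edges, between them. A path on four vertices has no such cut, while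
any two vertices of `G` are separated by the highest branching node of the cotree; when `x` is
inserted at a node with uniform children, this also gives the cuts of `G + x`. Conversely, if
`G + x` is a cograph and `v` is a lowest mixed node, a vertex `y` outside `V(v)` on which `x`
disagrees with the cotree yields an induced path on four vertices, because on the way from the
branching of `y` down to `v` the labels alternate. So the completions in which `V(u)` is mixed are
exactly those with an insertion node in the subtree of `u`.

If `u` is eligible, non-hollow and not forced, descending through unforced children of series nodes
reaches a non-hollow node with a hollow child, where `x` can be inserted by filling the non-hollow
children; an inclusion-minimal insertion below `u` is then a minimal completion. If `u` is hollow,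
deleting `V(u)` from the neighbourhood of `x` shrinks any completion with insertion node below `u`.
-/

namespace CographCompletion

open SimpleGraph

section HomogeneousCut

variable {W : Type*} {H : SimpleGraph W}

/-- `S` is a disjoint union or a join of two nonempty parts `S ∩ A` and `S \ A`: the proposition
`k` says whether the parts are joined by all edges or by none. -/
def HasHomogeneousCut (H : SimpleGraph W) (S : Set W) : Prop :=
  ∃ (A : Set W) (k : Prop), (S ∩ A).Nonempty ∧ (S \ A).Nonempty ∧
    ∀ a ∈ S ∩ A, ∀ b ∈ S \ A, (H.Adj a b ↔ k)

theorem HasHomogeneousCut.image {U : Type*} {K : SimpleGraph U} (f : H ↪g K) {S : Set W}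
    (hS : HasHomogeneousCut H S) : HasHomogeneousCut K (f '' S) := by
  obtain ⟨A, k, hA, hA', hcut⟩ := hS
  refine ⟨f '' A, k, ?_, ?_, ?_⟩
  · rw [← Set.image_inter f.injective]
    exact hA.image f
  · rw [← Set.image_sdiff f.injective]
    exact hA'.image f
  · rw [← Set.image_inter f.injective, ← Set.image_sdiff f.injective]
    rintro _ ⟨a, ha, rfl⟩ _ ⟨b, hb, rfl⟩
    exact f.map_adj_iff.trans (hcut a ha b hb)

theorem not_hasHomogeneousCut_range (f : pathGraph 4 ↪g H) :
    ¬ HasHomogeneousCut H (Set.range f) := by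
  classical
  rintro ⟨A, k, ⟨_, ⟨i, rfl⟩, hi⟩, ⟨_, ⟨j, rfl⟩, hj⟩, hcut⟩
  have path_uncut : ∀ (B : Fin 4 → Bool) (l : Bool), (∃ i, B i = true) → (∃ j, B j = false) →
      ¬ ∀ i j : Fin 4, B i = true → B j = false →
        ((i.val + 1 = j.val ∨ j.val + 1 = i.val) ↔ l = true) := by decide
  refine path_uncut (fun i => decide (f i ∈ A)) (decide k) ⟨i, by simpa using hi⟩
    ⟨j, by simpa using hj⟩ fun i j hi hj => ?_
  rw [← pathGraph_adj, ← f.map_adj_iff, decide_eq_true_iff]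
  exact hcut _ ⟨⟨i, rfl⟩, of_decide_eq_true hi⟩ _ ⟨⟨j, rfl⟩, of_decide_eq_false hj⟩

theorem isCograph_of_forall_hasHomogeneousCut
    (h : ∀ S : Set W, S.Nontrivial → HasHomogeneousCut H S) : IsCograph H := fun ⟨f⟩ =>
  not_hasHomogeneousCut_range f <| h _
    ⟨f 0, ⟨0, rfl⟩, f 1, ⟨1, rfl⟩, f.injective.ne (by decide)⟩

theorem IsCograph.not_induced_path (hH : IsCograph H) {a b c d : W} (hab : H.Adj a b)
    (hbc : H.Adj b c) (hcd : H.Adj c d) (hac : ¬ H.Adj a c) (hbd : ¬ H.Adj b d)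
    (had : ¬ H.Adj a d) : False := by
  have nab := hab.ne
  have nbc := hbc.ne
  have ncd := hcd.ne
  have nac : a ≠ c := by rintro rfl; exact had hcd
  have nad : a ≠ d := by rintro rfl; exact hac hcd.symm
  have nbd : b ≠ d := by rintro rfl; exact had hab
  refine hH ⟨⟨⟨![a, b, c, d], fun i j hij => ?_⟩, fun {i j} => ?_⟩⟩
  · fin_cases i <;> fin_cases j <;> simp_all
  · change H.Adj (![a, b, c, d] i) (![a, b, c, d] j) ↔ _
    rw [pathGraph_adj]
    fin_cases i <;> fin_cases j <;>
      simp [hab, hbc, hcd, hac, hbd, had, hab.symm, hbc.symm, hcd.symm, H.adj_comm c a,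
        H.adj_comm d b, H.adj_comm d a]

end HomogeneousCut

section Uniform

variable {V : Type*} {N S : Set V}

theorem not_isHollow_iff : ¬ IsHollow N S ↔ ∃ y ∈ S, y ∈ N := by
  rw [IsHollow, ← ne_eq, ← Set.nonempty_iff_ne_empty]
  rfl

theorem IsHollow.notMem (h : IsHollow N S) {y : V} (hy : y ∈ S) : y ∉ N :=
  fun hN => not_isHollow_iff.2 ⟨y, hy, hN⟩ h

theorem IsHollow.mono (h : IsHollow N S) {N' S' : Set V} (hN : N' ⊆ N) (hS : S' ⊆ S) :
    IsHollow N' S' :=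
  Set.subset_empty_iff.1 ((Set.inter_subset_inter hS hN).trans h.subset)

theorem not_isFull_iff : ¬ IsFull N S ↔ ∃ y ∈ S, y ∉ N := Set.not_subset

theorem not_isMixed_iff : ¬ IsMixed N S ↔ IsUniform N S := by
  unfold IsMixed IsUniform
  tauto

theorem IsUniform.mem_iff (h : IsUniform N S) {y z : V} (hy : y ∈ S) (hz : z ∈ S) :
    y ∈ N ↔ z ∈ N :=
  h.elim (fun h => iff_of_true (h hy) (h hz)) fun h => iff_of_false (h.notMem hy) (h.notMem hz)

theorem isUniform_singleton (N : Set V) (y : V) : IsUniform N {y} := by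
  simpa [IsUniform, IsFull, IsHollow] using em (y ∈ N)

end Uniform

section Completion

variable {V : Type*} {G : SimpleGraph V} {N M : Set V}

/-- The embedding of `G` into `G + x`. -/
def addVertexEmbedding (G : SimpleGraph V) (N : Set V) : G ↪g addVertex G N :=
  ⟨Function.Embedding.some, Iff.rfl⟩

/-- `M` is the neighbourhood of the new vertex in a completion of `G + x`. As all completions agree
on `G`, these sets stand for the completions themselves. -/
def IsCompletionNeighborhood (G : SimpleGraph V) (N M : Set V) : Prop :=
  N ⊆ M ∧ IsCograph (addVertex G M)

theorem addVertex_le_addVertex_iff : addVertex G N ≤ addVertex G M ↔ N ⊆ M := by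
  refine ⟨fun h y hy => h (show (addVertex G N).Adj none (some y) from hy), fun h => ?_⟩
  rintro (_ | y) (_ | z) hyz
  exacts [hyz, h hyz, h hyz, hyz]

theorem IsCompletion.eq_addVertex {H : SimpleGraph (Option V)} (h : IsCompletion G N H) :
    H = addVertex G (newNeighbors H) := by
  ext (_ | y) (_ | z)
  · exact ⟨fun h' => (H.irrefl h').elim, False.elim⟩
  · exact Iff.rfl
  · exact H.adj_comm _ _
  · exact ⟨h.2.1 y z, fun h' => h.1 (show (addVertex G N).Adj (some y) (some z) from h')⟩

theorem isCompletion_addVertex_iff :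
    IsCompletion G N (addVertex G M) ↔ IsCompletionNeighborhood G N M :=
  ⟨fun h => ⟨addVertex_le_addVertex_iff.1 h.1, h.2.2⟩,
    fun h => ⟨addVertex_le_addVertex_iff.2 h.1, fun _ _ h => h, h.2⟩⟩

theorem minimal_isCompletion_addVertex_iff :
    Minimal (IsCompletion G N) (addVertex G M) ↔ Minimal (IsCompletionNeighborhood G N) M := by
  refine ⟨fun h => ⟨isCompletion_addVertex_iff.1 h.prop, fun M' hM' hle => ?_⟩,
    fun h => ⟨isCompletion_addVertex_iff.2 h.prop, fun H hH hle => ?_⟩⟩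
  · exact addVertex_le_addVertex_iff.1
      (h.le_of_le (isCompletion_addVertex_iff.2 hM') (addVertex_le_addVertex_iff.2 hle))
  · obtain ⟨M', rfl⟩ : ∃ M', H = addVertex G M' := ⟨_, hH.eq_addVertex⟩
    exact addVertex_le_addVertex_iff.2
      (h.le_of_le (isCompletion_addVertex_iff.1 hH) (addVertex_le_addVertex_iff.1 hle))

/-- Otherwise there is an induced path: `x, c, y, d` if `k` holds, and `y, x, c, d` if it fails. -/
theorem mem_iff_of_isCograph_addVertex (h : IsCograph (addVertex G N)) {y c d : V} {k : Prop}
    (hc : c ∈ N) (hd : d ∉ N) (hyc : G.Adj y c ↔ k) (hyd : G.Adj y d ↔ k)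
    (hcd : G.Adj c d ↔ ¬ k) : y ∈ N ↔ k := by
  have xc : (addVertex G N).Adj none (some c) := hc
  have xd : ¬ (addVertex G N).Adj none (some d) := hd
  have yc : (addVertex G N).Adj (some y) (some c) ↔ k := hyc
  have yd : (addVertex G N).Adj (some y) (some d) ↔ k := hyd
  have cd : (addVertex G N).Adj (some c) (some d) ↔ ¬ k := hcd
  change (addVertex G N).Adj none (some y) ↔ k
  by_cases hk : k
  · simp only [hk, not_true_eq_false, iff_true, iff_false] at yc yd cd ⊢
    by_contra xy
    exact h.not_induced_path xc yc.symm yd xy cd xd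
  · simp only [hk, not_false_eq_true, iff_true, iff_false] at yc yd cd ⊢
    intro xy
    exact h.not_induced_path xy.symm xc cd yc xd yd

end Completion

section TreeOrder

variable {α : Type*} [SemilatticeInf α] [PredOrder α] [IsPredArchimedean α] {a b c d u v : α}

theorem child_unique (hc : u ⋖ c) (hd : u ⋖ d) (hca : c ≤ a) (hda : d ≤ a) : c = d :=
  (le_total_of_directed hda hca).elim (fun h => h.eq_of_not_lt (hd.2 hc.lt))
    fun h => (h.eq_of_not_lt (hc.2 hd.lt)).symm

theorem inf_eq_of_child (hc : u ⋖ c) (ha : c ≤ a) (hb : u ≤ b) (hcb : ¬ c ≤ b) : a ⊓ b = u := by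
  have hu : u ≤ a ⊓ b := le_inf (hc.le.trans ha) hb
  rcases le_total_of_directed ha (inf_le_left : a ⊓ b ≤ a) with h | h
  · exact (hc.eq_or_eq hu h).resolve_right fun h => hcb (h ▸ inf_le_right)
  · exact (hcb (h.trans inf_le_right)).elim

theorem inf_eq_inf_of_le (huv : u ≤ v) (h : ¬ u ≤ a) : a ⊓ v = a ⊓ u := by
  rcases le_total_of_directed huv (inf_le_right : a ⊓ v ≤ v) with h' | h'
  · exact le_antisymm (le_inf inf_le_left h') (inf_le_inf_left a huv)
  · exact (h (h'.trans inf_le_left)).elim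

theorem inf_eq_inf_of_inf_lt (h : b ⊓ u < a ⊓ u) : b ⊓ a = b ⊓ u := by
  have h' : ¬ a ⊓ u ≤ b := fun hb => h.not_ge (le_inf hb inf_le_right)
  rw [inf_eq_inf_of_le inf_le_left h', inf_eq_inf_of_le inf_le_right h']

end TreeOrder

namespace Cotree

variable {V : Type*} {G : SimpleGraph V} {T : Cotree G} {N M : Set V} {u v w : T.tree}

instance (T : Cotree G) : Finite T.tree := T.finite_tree

section Nodes

theorem verts_anti (h : u ≤ v) : T.verts v ⊆ T.verts u := fun _ hy => h.trans hy

theorem kind_leaf (T : Cotree G) (y : V) : T.kind (T.leaf y) = .leaf :=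
  T.range_leaf.subset ⟨y, rfl⟩

theorem exists_leaf_eq (h : T.kind u = .leaf) : ∃ y, T.leaf y = u := T.range_leaf.superset h

theorem verts_leaf (T : Cotree G) (y : V) : T.verts (T.leaf y) = {y} := by
  ext z
  refine ⟨fun h => T.leaf_injective ?_, fun h => (congrArg T.leaf h).ge⟩
  exact (((T.kind_eq_leaf_iff _).1 (T.kind_leaf y)).eq_of_le h).symm

theorem isUniform_verts_of_leaf (h : T.kind u = .leaf) : IsUniform N (T.verts u) := by
  obtain ⟨y, rfl⟩ := exists_leaf_eq h
  exact T.verts_leaf y ▸ isUniform_singleton N y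

theorem verts_nonempty (u : T.tree) : (T.verts u).Nonempty := by
  obtain ⟨m, hum, hm⟩ := Set.finite_univ.exists_le_maximal (Set.mem_univ u)
  obtain ⟨y, rfl⟩ := exists_leaf_eq ((T.kind_eq_leaf_iff m).2 fun b hb => hm.2 (Set.mem_univ b) hb)
  exact ⟨y, hum⟩

theorem kind_ne_leaf_of_lt (h : u < v) : T.kind u ≠ .leaf := fun hk =>
  h.not_ge ((T.kind_eq_leaf_iff u).1 hk h.le)

theorem kind_eq_parallel (h : T.kind u ≠ .leaf) (h' : T.kind u ≠ .series) :
    T.kind u = .parallel := by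
  cases hk : T.kind u <;> simp_all

theorem kind_ne_of_covBy (h : u ⋖ v) : T.kind u ≠ T.kind v := by
  intro hk
  cases hv : T.kind v with
  | leaf => exact kind_ne_leaf_of_lt h.lt (hk.trans hv)
  | parallel => exact T.no_adjacent_parallel u v h (hk.trans hv) hv
  | series => exact T.no_adjacent_series u v h (hk.trans hv) hv

theorem kind_eq_series_iff_ne_series (hu : T.kind u ≠ .leaf) (hv : T.kind v ≠ .leaf)
    (huv : T.kind u ≠ T.kind v) : T.kind u = .series ↔ ¬ T.kind v = .series := by
  cases hku : T.kind u <;> cases hkv : T.kind v <;> simp_all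

theorem exists_child_mem (h : T.kind u ≠ .leaf) {y : V} (hy : y ∈ T.verts u) :
    ∃ c, u ⋖ c ∧ y ∈ T.verts c :=
  exists_covBy_le_of_lt (hy.lt_of_ne fun hu => h (hu ▸ T.kind_leaf y))

theorem exists_child_not_le (h : T.kind u ≠ .leaf) (v : T.tree) : ∃ c, u ⋖ c ∧ ¬ c ≤ v := by
  obtain ⟨c, d, hc, hd, hcd⟩ := T.two_children u h
  by_cases hcv : c ≤ v
  · exact ⟨d, hd, fun hdv => hcd (child_unique hc hd hcv hdv)⟩
  · exact ⟨c, hc, hcv⟩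

theorem exists_inf_eq_of_lt (h : u < v) : ∃ z, T.leaf z ⊓ v = u := by
  obtain ⟨c, hc, hcv⟩ := exists_child_not_le (kind_ne_leaf_of_lt h) v
  obtain ⟨z, hz⟩ := T.verts_nonempty c
  exact ⟨z, inf_eq_of_child hc hz h.le hcv⟩

theorem exists_child_not_isHollow (hk : T.kind u ≠ .leaf) (hu : ¬ IsHollow N (T.verts u)) :
    ∃ c, u ⋖ c ∧ ¬ IsHollow N (T.verts c) := by
  obtain ⟨y, hy, hyN⟩ := not_isHollow_iff.1 hu
  obtain ⟨c, hc, hyc⟩ := exists_child_mem hk hy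
  exact ⟨c, hc, not_isHollow_iff.2 ⟨y, hyc, hyN⟩⟩

theorem adj_iff_kind_inf {y z : V} : G.Adj y z ↔ T.kind (T.leaf y ⊓ T.leaf z) = .series := by
  rcases eq_or_ne y z with rfl | h
  · simp [T.kind_leaf]
  · exact T.adj_iff y z h

theorem inf_eq_of_uniform_children (h : ∀ c, u ⋖ c → IsUniform N (T.verts c)) {y z : V}
    (hy : y ∈ T.verts u) (hz : z ∈ T.verts u) (hyz : ¬ (y ∈ N ↔ z ∈ N)) :
    T.leaf y ⊓ T.leaf z = u := by
  have hk : T.kind u ≠ .leaf := fun hk => hyz ((isUniform_verts_of_leaf hk).mem_iff hy hz)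
  obtain ⟨c, hc, hyc⟩ := exists_child_mem hk hy
  exact inf_eq_of_child hc hyc hz fun hzc => hyz ((h c hc).mem_iff hyc hzc)

end Nodes

section Insertion

theorem exists_highest_branching {S : Set V} (h : ∃ y ∈ S, y ∉ T.verts u) :
    ∃ m < u, (∃ y ∈ S, T.leaf y ⊓ u = m) ∧ ∀ a, T.leaf a ⊓ u = m → ∀ b ∈ S, T.leaf b ⊓ u ≠ m →
      (G.Adj a b ↔ T.kind m = .series) := by
  obtain ⟨y, hy, hyu⟩ := h
  obtain ⟨m, hmy, hmS, hmin⟩ :=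
    (Set.toFinite ((fun y => T.leaf y ⊓ u) '' S)).exists_le_minimal ⟨y, hy, rfl⟩
  refine ⟨m, hmy.trans_lt (inf_lt_right.2 hyu), hmS, ?_⟩
  rintro a rfl b hb hab
  have hle : T.leaf a ⊓ u ≤ T.leaf b ⊓ u :=
    (le_total_of_directed inf_le_right inf_le_right).elim id (hmin ⟨b, hb, rfl⟩)
  rw [T.adj_iff_kind_inf, inf_eq_inf_of_inf_lt (hle.lt_of_ne' hab)]

theorem hasHomogeneousCut (T : Cotree G) {S : Set V} (hS : S.Nontrivial) :
    HasHomogeneousCut G S := by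
  obtain ⟨x, hx, z, hz, hxz⟩ := hS
  obtain ⟨m, hm, ⟨y, hy, hym⟩, hcut⟩ := T.exists_highest_branching (u := T.leaf x)
    ⟨z, hz, by simpa [T.verts_leaf] using hxz.symm⟩
  exact ⟨{z | T.leaf z ⊓ T.leaf x = m}, T.kind m = .series, ⟨y, hy, hym⟩,
    ⟨x, hx, fun h => hm.ne' ((inf_idem _).symm.trans h)⟩, fun a ha b hb => hcut a ha.2 b hb.1 hb.2⟩

theorem hasHomogeneousCut_addVertex_of_outside
    (hout : ∀ y, y ∉ T.verts u → (y ∈ N ↔ T.kind (T.leaf y ⊓ u) = .series))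
    {S : Set (Option V)} (hx : none ∈ S) (hS : ∃ y, some y ∈ S ∧ y ∉ T.verts u) :
    HasHomogeneousCut (addVertex G N) S := by
  obtain ⟨m, hm, ⟨y, hy, hym⟩, hcut⟩ := T.exists_highest_branching (S := {y | some y ∈ S}) hS
  refine ⟨some '' {z | T.leaf z ⊓ u = m}, T.kind m = .series, ⟨some y, hy, y, hym, rfl⟩,
    ⟨none, hx, by simp⟩, ?_⟩
  rintro _ ⟨-, a, rfl, rfl⟩ (_ | b) ⟨hb, hab⟩
  · exact hout a (inf_lt_right.1 hm)
  · exact hcut a rfl b hb fun h => hab ⟨b, h, rfl⟩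

theorem hasHomogeneousCut_addVertex_of_inside (hu : ∀ c, u ⋖ c → IsUniform N (T.verts c))
    {S : Set (Option V)} (hS : S.Nontrivial) (hx : none ∈ S)
    (hin : ∀ y, some y ∈ S → y ∈ T.verts u) : HasHomogeneousCut (addVertex G N) S := by
  by_cases hA : ∃ y, some y ∈ S ∧ (y ∈ N ↔ T.kind u = .series)
  · obtain ⟨y, hy, hyN⟩ := hA
    refine ⟨some '' {y | y ∈ N ↔ T.kind u = .series}, T.kind u = .series,
      ⟨some y, hy, y, hyN, rfl⟩, ⟨none, hx, by simp⟩, ?_⟩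
    rintro _ ⟨ha, a, haN, rfl⟩ (_ | b) ⟨hb, hbN⟩
    · exact haN
    · have hab : ¬ (a ∈ N ↔ b ∈ N) := fun h => hbN ⟨b, h.symm.trans haN, rfl⟩
      have huab := inf_eq_of_uniform_children hu (hin a ha) (hin b hb) hab
      exact huab ▸ T.adj_iff_kind_inf
  · obtain ⟨y, hy, hyx⟩ := hS.exists_ne none
    refine ⟨{none}, ¬ T.kind u = .series, ⟨none, hx, rfl⟩, ⟨y, hy, hyx⟩, ?_⟩
    rintro _ ⟨-, rfl⟩ (_ | b) ⟨hb, hbx⟩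
    · exact (hbx rfl).elim
    · change b ∈ N ↔ _
      exact iff_not_comm.1 (not_iff.1 fun h => hA ⟨b, hb, h⟩).symm

theorem isCograph_addVertex (hu : ∀ c, u ⋖ c → IsUniform N (T.verts c))
    (hout : ∀ y, y ∉ T.verts u → (y ∈ N ↔ T.kind (T.leaf y ⊓ u) = .series)) :
    IsCograph (addVertex G N) := by
  refine isCograph_of_forall_hasHomogeneousCut fun S hS => ?_
  by_cases hx : none ∈ S
  · by_cases hin : ∀ y, some y ∈ S → y ∈ T.verts u
    · exact hasHomogeneousCut_addVertex_of_inside hu hS hx hin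
    · push Not at hin
      exact hasHomogeneousCut_addVertex_of_outside hout hx hin
  · obtain ⟨S, rfl⟩ : ∃ S', some '' S' = S :=
      Set.subset_range_iff_exists_image_eq.1 fun y hy =>
        Option.ne_none_iff_exists.1 fun h => hx (h ▸ hy)
    exact (T.hasHomogeneousCut (Set.nontrivial_of_image _ _ hS)).image (addVertexEmbedding G N)

end Insertion

section InsertionNode

theorem exists_inf_between_kind_ne (h : w < v) (hk : T.kind w = T.kind v) :
    ∃ z, w < T.leaf z ⊓ v ∧ T.leaf z ⊓ v < v ∧ T.kind (T.leaf z ⊓ v) ≠ T.kind w := by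
  obtain ⟨p, hwp, hpv⟩ := exists_le_covBy_of_lt h
  have hpk : T.kind p ≠ T.kind w := hk ▸ kind_ne_of_covBy hpv
  obtain ⟨z, rfl⟩ := exists_inf_eq_of_lt hpv.lt
  exact ⟨z, hwp.lt_of_ne fun hw => hpk (congrArg T.kind hw.symm), hpv.lt, hpk⟩

theorem exists_adj_iff_not_series (hv : IsMixed N (T.verts v))
    (hchild : ∀ c, v ⋖ c → IsUniform N (T.verts c)) {y : V} (hy : y ∉ T.verts v) :
    ∃ c ∈ N, ∃ d ∉ N, T.leaf y ⊓ T.leaf c = T.leaf y ⊓ v ∧ T.leaf y ⊓ T.leaf d = T.leaf y ⊓ v ∧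
      (G.Adj c d ↔ ¬ T.kind (T.leaf y ⊓ v) = .series) := by
  obtain ⟨b, hb, hbN⟩ := not_isFull_iff.1 hv.1
  obtain ⟨a, ha, haN⟩ := not_isHollow_iff.1 hv.2
  have hab : T.leaf a ⊓ T.leaf b = v :=
    inf_eq_of_uniform_children hchild ha hb (by simp [haN, hbN])
  have hvk : T.kind v ≠ .leaf := fun hk => not_isMixed_iff.2 (isUniform_verts_of_leaf hk) hv
  have hwv : T.leaf y ⊓ v < v := inf_lt_right.2 hy
  have hwk := kind_ne_leaf_of_lt hwv
  have hya : T.leaf y ⊓ T.leaf a = T.leaf y ⊓ v := inf_eq_inf_of_le ha hy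
  have hyb : T.leaf y ⊓ T.leaf b = T.leaf y ⊓ v := inf_eq_inf_of_le hb hy
  by_cases hk : T.kind (T.leaf y ⊓ v) = T.kind v
  · obtain ⟨z, hwz, hzv, hzk⟩ := exists_inf_between_kind_ne hwv hk
    have hyz : T.leaf y ⊓ T.leaf z = T.leaf y ⊓ v := inf_eq_inf_of_inf_lt hwz
    have adj_z {e : V} (he : e ∈ T.verts v) :
        G.Adj z e ↔ ¬ T.kind (T.leaf y ⊓ v) = .series := by
      rw [T.adj_iff_kind_inf, inf_eq_inf_of_le he (inf_lt_right.1 hzv)]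
      exact kind_eq_series_iff_ne_series (kind_ne_leaf_of_lt hzv) hwk hzk
    by_cases hzN : z ∈ N
    · exact ⟨z, hzN, b, hbN, hyz, hyb, adj_z hb⟩
    · exact ⟨a, haN, z, hzN, hya, hyz, (G.adj_comm a z).trans (adj_z ha)⟩
  · refine ⟨a, haN, b, hbN, hya, hyb, ?_⟩
    rw [T.adj_iff_kind_inf, hab]
    exact kind_eq_series_iff_ne_series hvk hwk (Ne.symm hk)

theorem exists_isInsertionNode (hN : IsCograph (addVertex G N)) (hu : IsMixed N (T.verts u)) :
    ∃ v, u ≤ v ∧ T.IsInsertionNode N v := by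
  obtain ⟨v, huv, hv⟩ :=
    (Set.toFinite {v : T.tree | IsMixed N (T.verts v)}).exists_le_maximal hu
  have hchild : ∀ c, v ⋖ c → IsUniform N (T.verts c) := fun c hc =>
    not_isMixed_iff.1 fun h => hc.lt.not_ge (hv.le_of_ge h hc.le)
  refine ⟨v, huv, hv.prop, hchild, fun y hy => ?_⟩
  obtain ⟨c, hc, d, hd, hyc, hyd, hcd⟩ := exists_adj_iff_not_series hv.prop hchild hy
  exact mem_iff_of_isCograph_addVertex hN hc hd (hyc ▸ T.adj_iff_kind_inf)
    (hyd ▸ T.adj_iff_kind_inf) hcd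

theorem IsInsertionNode.isCograph_addVertex (h : T.IsInsertionNode M v) :
    IsCograph (addVertex G M) :=
  Cotree.isCograph_addVertex h.2.1 h.2.2

theorem IsInsertionNode.mem_iff (h : T.IsInsertionNode M v) (huv : u ≤ v) {y : V}
    (hy : y ∉ T.verts u) : y ∈ M ↔ T.kind (T.leaf y ⊓ u) = .series := by
  rw [h.2.2 y fun hyv => hy (huv.trans hyv), inf_eq_inf_of_le huv hy]

theorem IsInsertionNode.isHollow_of_parallel (h : T.IsInsertionNode M v) (hwv : w < v)
    (hw : T.kind w = .parallel) {c : T.tree} (hc : w ⋖ c) (hcv : ¬ c ≤ v) :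
    IsHollow M (T.verts c) := by
  by_contra hh
  obtain ⟨y, hy, hyM⟩ := not_isHollow_iff.1 hh
  have hyv : T.leaf y ⊓ v = w := inf_eq_of_child hc hy hwv.le hcv
  have hs := (h.2.2 y (inf_lt_right.1 (hyv.trans_lt hwv))).1 hyM
  simp [hyv, hw] at hs

theorem IsInsertionNode.exists_child_isHollow (h : T.IsInsertionNode M v) :
    ∃ c, v ⋖ c ∧ IsHollow M (T.verts c) := by
  have hk : T.kind v ≠ .leaf := fun hk => not_isMixed_iff.2 (isUniform_verts_of_leaf hk) h.1
  obtain ⟨y, hy, hyM⟩ := not_isFull_iff.1 h.1.1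
  obtain ⟨c, hc, hyc⟩ := exists_child_mem hk hy
  exact ⟨c, hc, (h.2.1 c hc).resolve_left fun hfull => hyM (hfull hyc)⟩

theorem isCompletionMinimalInsertionNode_iff :
    T.IsCompletionMinimalInsertionNode N u ↔
      ∃ M, Minimal (IsCompletionNeighborhood G N) M ∧ T.IsInsertionNode M u := by
  constructor
  · rintro ⟨H, hH, hu⟩
    refine ⟨newNeighbors H, ?_, hu⟩
    rw [← minimal_isCompletion_addVertex_iff, ← hH.prop.eq_addVertex]
    exact hH
  · rintro ⟨M, hM, hu⟩
    exact ⟨addVertex G M, minimal_isCompletion_addVertex_iff.2 hM, hu⟩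

end InsertionNode

section Necessity

theorem IsInsertionNode.isEligible (hv : T.IsInsertionNode M v) (hNM : N ⊆ M) (huv : u ≤ v) :
    T.IsEligible N u := by
  intro w hwu hw c hc hcu
  obtain ⟨d, hd, hdu⟩ := exists_covBy_le_of_lt hwu
  have hcv : ¬ c ≤ v := fun hcv => hcu (child_unique hc hd hcv (hdu.trans huv) ▸ hdu)
  exact (hv.isHollow_of_parallel (hwu.trans_le huv) hw hc hcv).mono hNM subset_rfl

theorem IsInsertionNode.isCograph_addVertex_sdiff (hv : T.IsInsertionNode M v) (huv : u ≤ v) :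
    IsCograph (addVertex G (M \ T.verts u)) := by
  have hu : IsHollow (M \ T.verts u) (T.verts u) := Set.inter_sdiff_self _ _
  refine Cotree.isCograph_addVertex (u := u)
    (fun c hc => .inr (hu.mono subset_rfl (verts_anti hc.le))) fun z hz => ?_
  rw [← hv.mem_iff huv hz]
  exact and_iff_left hz

theorem IsInsertionNode.not_isHollow_of_minimal (hv : T.IsInsertionNode M v)
    (hM : Minimal (IsCompletionNeighborhood G N) M) (huv : u ≤ v) :
    ¬ IsHollow N (T.verts u) := by
  intro hh
  obtain ⟨y, hy, hyM⟩ := not_isHollow_iff.1 hv.1.2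
  have hsub : N ⊆ M \ T.verts u := fun z hz => ⟨hM.prop.1 hz, fun h => hh.notMem h hz⟩
  have hle : M ⊆ M \ T.verts u :=
    hM.le_of_le ⟨hsub, hv.isCograph_addVertex_sdiff huv⟩ Set.sdiff_subset
  exact (hle hyM).2 (verts_anti huv hy)

theorem not_isHollow_of_le (h : u ≤ v) (hv : ¬ IsHollow N (T.verts v)) :
    ¬ IsHollow N (T.verts u) :=
  fun hu => hv (hu.mono subset_rfl (verts_anti h))

theorem IsForced.not_isHollow (h : T.IsForced N u) : ¬ IsHollow N (T.verts u) := by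
  induction h with
  | full u h =>
    obtain ⟨y, hy⟩ := T.verts_nonempty u
    exact not_isHollow_iff.2 ⟨y, hy, h hy⟩
  | parallel u hk h =>
    obtain ⟨c, -, hc, -⟩ := T.two_children u (by simp [hk])
    exact not_isHollow_of_le hc.le (h c hc)
  | series u hk _ ih =>
    obtain ⟨c, -, hc, -⟩ := T.two_children u (by simp [hk])
    exact not_isHollow_of_le hc.le (ih c hc)

theorem IsInsertionNode.not_isForced (hv : T.IsInsertionNode M v) (hNM : N ⊆ M) (huv : u ≤ v) :
    ¬ T.IsForced N u := by
  intro h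
  induction h with
  | full u h => exact hv.1.1 ((verts_anti huv).trans (h.trans hNM))
  | parallel u hk h =>
    obtain ⟨c, hc, hcM⟩ : ∃ c, u ⋖ c ∧ IsHollow M (T.verts c) := by
      rcases huv.eq_or_lt with rfl | huv
      · exact hv.exists_child_isHollow
      · obtain ⟨c, hc, hcv⟩ := exists_child_not_le (kind_ne_leaf_of_lt huv) v
        exact ⟨c, hc, hv.isHollow_of_parallel huv hk hc hcv⟩
    exact h c hc (hcM.mono hNM subset_rfl)
  | series u _ h ih =>
    rcases huv.eq_or_lt with rfl | huv
    · obtain ⟨c, hc, hcM⟩ := hv.exists_child_isHollow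
      exact (h c hc).not_isHollow (hcM.mono hNM subset_rfl)
    · obtain ⟨c, hc, hcv⟩ := exists_covBy_le_of_lt huv
      exact ih c hc hcv

end Necessity

section Sufficiency

theorem IsEligible.kind_inf (h : T.IsEligible N u) {y : V} (hy : y ∉ T.verts u)
    (hyN : y ∈ N) : T.kind (T.leaf y ⊓ u) = .series := by
  have hlt : T.leaf y ⊓ u < u := inf_lt_right.2 hy
  have hk := kind_ne_leaf_of_lt hlt
  by_contra hs
  obtain ⟨c, hc, hyc⟩ := exists_child_mem hk (inf_le_left : T.leaf y ⊓ u ≤ T.leaf y)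
  have hcu : ¬ c ≤ u := fun hcu => hc.lt.not_ge (le_inf hyc hcu)
  exact (h _ hlt (kind_eq_parallel hk hs) c hc hcu).notMem hyc hyN

theorem IsEligible.child (h : T.IsEligible N u) (hs : T.kind u = .series) {c : T.tree}
    (hc : u ⋖ c) : T.IsEligible N c := by
  intro v hv hvk w hw hwc
  have hvu : v ≤ u := (le_total_of_directed hc.le hv.le).elim id fun h =>
    (h.eq_of_not_lt fun h => hc.2 h hv).ge
  have hne : v ≠ u := fun h => by simp [h, hs] at hvk
  exact h v (hvu.lt_of_ne hne) hvk w hw fun h => hwc (h.trans hc.le)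

theorem IsEligible.exists_descendant_child_isHollow (he : T.IsEligible N u)
    (hh : ¬ IsHollow N (T.verts u)) (hf : ¬ T.IsForced N u) :
    ∃ v, u ≤ v ∧ T.IsEligible N v ∧ ¬ IsHollow N (T.verts v) ∧
      ∃ c, v ⋖ c ∧ IsHollow N (T.verts c) := by
  induction u using WellFoundedGT.induction with
  | ind u ih =>
  by_cases hcN : ∃ c, u ⋖ c ∧ IsHollow N (T.verts c)
  · exact ⟨u, le_rfl, he, hh, hcN⟩
  push Not at hcN
  cases hk : T.kind u with
  | leaf => exact absurd (.full u ((isUniform_verts_of_leaf hk).resolve_right hh)) hf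
  | parallel => exact absurd (.parallel u hk hcN) hf
  | series =>
    obtain ⟨c, hc, hcf⟩ : ∃ c, u ⋖ c ∧ ¬ T.IsForced N c := by
      by_contra! hforced
      exact hf (.series u hk hforced)
    obtain ⟨v, hcv, hv⟩ := ih c hc.lt (he.child hk hc) (hcN c hc) hcf
    exact ⟨v, hc.le.trans hcv, hv⟩

/-- The neighbourhood of the new vertex when it is inserted at `u` with all non-hollow children of
`u` filled. It contains `N` as soon as `u` is eligible. -/
def filledNeighborhood (T : Cotree G) (N : Set V) (u : T.tree) : Set V :=
  {y | (∃ c, u ⋖ c ∧ y ∈ T.verts c ∧ ¬ IsHollow N (T.verts c)) ∨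
    (y ∉ T.verts u ∧ T.kind (T.leaf y ⊓ u) = .series)}

theorem mem_filledNeighborhood_of_child {c : T.tree} (hc : u ⋖ c) {y : V} (hy : y ∈ T.verts c) :
    y ∈ T.filledNeighborhood N u ↔ ¬ IsHollow N (T.verts c) := by
  refine ⟨?_, fun h => .inl ⟨c, hc, hy, h⟩⟩
  rintro (⟨d, hd, hyd, hdN⟩ | ⟨hyu, -⟩)
  · rwa [child_unique hc hd hy hyd]
  · exact (hyu (verts_anti hc.le hy)).elim

theorem mem_filledNeighborhood_of_notMem {y : V} (hy : y ∉ T.verts u) :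
    y ∈ T.filledNeighborhood N u ↔ T.kind (T.leaf y ⊓ u) = .series := by
  refine ⟨?_, fun hs => .inr ⟨hy, hs⟩⟩
  rintro (⟨c, hc, hyc, -⟩ | h)
  · exact (hy (verts_anti hc.le hyc)).elim
  · exact h.2

theorem IsEligible.subset_filledNeighborhood (h : T.IsEligible N u) (hk : T.kind u ≠ .leaf) :
    N ⊆ T.filledNeighborhood N u := by
  intro y hyN
  by_cases hy : y ∈ T.verts u
  · obtain ⟨c, hc, hyc⟩ := exists_child_mem hk hy
    exact (mem_filledNeighborhood_of_child hc hyc).2 (not_isHollow_iff.2 ⟨y, hyc, hyN⟩)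
  · exact (mem_filledNeighborhood_of_notMem hy).2 (h.kind_inf hy hyN)

theorem isInsertionNode_filledNeighborhood (hh : ¬ IsHollow N (T.verts u))
    (hc : ∃ c, u ⋖ c ∧ IsHollow N (T.verts c)) :
    T.IsInsertionNode (T.filledNeighborhood N u) u := by
  obtain ⟨c, hc, hcN⟩ := hc
  obtain ⟨d, hd, hdN⟩ := exists_child_not_isHollow (kind_ne_leaf_of_lt hc.lt) hh
  obtain ⟨y, hy⟩ := T.verts_nonempty c
  obtain ⟨z, hz⟩ := T.verts_nonempty d
  refine ⟨⟨not_isFull_iff.2 ⟨y, verts_anti hc.le hy, ?_⟩,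
    not_isHollow_iff.2 ⟨z, verts_anti hd.le hz, (mem_filledNeighborhood_of_child hd hz).2 hdN⟩⟩,
    fun e he => ?_, fun y hy => mem_filledNeighborhood_of_notMem hy⟩
  · exact fun hyM => (mem_filledNeighborhood_of_child hc hy).1 hyM hcN
  · refine or_iff_not_imp_right.2 fun heM x hx => (mem_filledNeighborhood_of_child he hx).2 ?_
    obtain ⟨w, hw, hwM⟩ := not_isHollow_iff.1 heM
    exact (mem_filledNeighborhood_of_child he hw).1 hwM

theorem exists_isInsertionNode_of_not_isForced (he : T.IsEligible N u)
    (hh : ¬ IsHollow N (T.verts u)) (hf : ¬ T.IsForced N u) :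
    ∃ M, N ⊆ M ∧ ∃ v, u ≤ v ∧ T.IsInsertionNode M v := by
  obtain ⟨v, huv, hev, hhv, hcv⟩ := he.exists_descendant_child_isHollow hh hf
  have hk : T.kind v ≠ .leaf := kind_ne_leaf_of_lt hcv.choose_spec.1.lt
  exact ⟨T.filledNeighborhood N v, hev.subset_filledNeighborhood hk, v, huv,
    isInsertionNode_filledNeighborhood hhv hcv⟩

theorem exists_isCompletionMinimalInsertionNode (hh : ¬ IsHollow N (T.verts u))
    (h : ∃ M, N ⊆ M ∧ ∃ v, u ≤ v ∧ T.IsInsertionNode M v) :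
    ∃ v, u ≤ v ∧ T.IsCompletionMinimalInsertionNode N v := by
  have : Finite V := .of_injective T.leaf T.leaf_injective
  obtain ⟨M, hM⟩ :=
    (Set.toFinite {M | N ⊆ M ∧ ∃ v, u ≤ v ∧ T.IsInsertionNode M v}).exists_minimal h
  obtain ⟨hNM, v, huv, hv⟩ := hM.prop
  refine ⟨v, huv, isCompletionMinimalInsertionNode_iff.2
    ⟨M, ⟨⟨hNM, hv.isCograph_addVertex⟩, fun M' hM' hle => ?_⟩, hv⟩⟩
  have hmixed : IsMixed M' (T.verts u) :=
    ⟨fun hfull => hv.1.1 ((verts_anti huv).trans (hfull.trans hle)),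
      fun hhollow => hh (hhollow.mono hM'.1 subset_rfl)⟩
  exact hM.le_of_le ⟨hM'.1, exists_isInsertionNode hM'.2 hmixed⟩ hle

end Sufficiency

end Cotree

end CographCompletion

theorem lemma5 {V : Type*} [Finite V] (G : SimpleGraph V)
    (hG : CographCompletion.IsCograph G) (T : CographCompletion.Cotree G)
    (N : Set V) (hN_nonempty : N.Nonempty) (hN_ne_univ : N ≠ Set.univ) (u : T.tree) :
    (∃ v : T.tree, u ≤ v ∧ T.IsCompletionMinimalInsertionNode N v) ↔
      T.IsEligible N u ∧ ¬ CographCompletion.IsHollow N (T.verts u) ∧ ¬ T.IsForced N u := by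
  constructor
  · rintro ⟨v, huv, hv⟩
    obtain ⟨M, hM, hvM⟩ := CographCompletion.Cotree.isCompletionMinimalInsertionNode_iff.1 hv
    exact ⟨hvM.isEligible hM.prop.1 huv, hvM.not_isHollow_of_minimal hM huv,
      hvM.not_isForced hM.prop.1 huv⟩
  · rintro ⟨he, hh, hf⟩
    exact CographCompletion.Cotree.exists_isCompletionMinimalInsertionNode hh
      (CographCompletion.Cotree.exists_isInsertionNode_of_not_isForced he hh hf)
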